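/- **Corollary (reverse Myerson auctions).** A buyer with known valuation $v_0\in\mathbb R$ procures a service from one of $n$ bidders. Bidder $i$ has a private cost $v_i$; the costs are independent, and $v_i$ has CDF $F_i$ and a density $f_i$ that is strictly positive exactly on an interval $\Theta_i\subseteq\mathbb R$ (open, closed or half-open, possibly unbounded), and $\mathbb E[\max(-v_i,0)]<\infty$ (automatic for nonnegative costs). Let $c_i(x)=x+F_i(x)/f_i(x)$ for $x\in\Theta_i$ be the reverse virtual valuation of bidder $i$, and let $c_0(v_0)=v_0$. Assume the auction is *regular*: each $c_i$, $1\le i\le n$, is nondecreasing on $\Theta_i$. A direct mechanism consists of measurable functions of the reported costs $v=(v_1,\dots,v_n)$: selection probabilities $p_i(v)\ge 0$ with $\sum_{i=1}^n p_i(v)\le 1$, and payments $x_i(v)$ from the buyer to bidder $i$ with finite ex-ante expectation and, for every report in $\Theta_i$ of bidder $i$, finite interim expectation. It is *feasible* if it is Bayesian incentive compatible and interim individually rational: for each bidder $i$ and each true cost $t\in\Theta_i$, when the others report truthfully, reporting $t$ maximizes the interim utility $\mathbb E[x_i-t\,p_i]$ over all reports in $\Theta_i$, and gives a nonnegative value.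 A feasible mechanism is *buyer-optimal* if it maximizes the buyer's expected utility $\mathbb E\big[v_0\sum_i p_i(v)-\sum_i x_i(v)\big]$ among all feasible direct mechanisms. A pair $(\rho,X)$, with $\rho(v)\in\{0,1,\dots,n\}$, denotes the mechanism in which bidder $\rho(v)$ is selected and paid $X(v)$ and the others are paid nothing; $\rho(v)=0$ means that no bidder is selected and nothing is paid. 1. Suppose that almost surely no two of $c_0(v_0),c_1(v_1),\dots,c_n(v_n)$ are equal. Let $\rho(v)\in\arg\min_{0\le i\le n}c_i(v_i)$ be any measurable selection, let $X(v)=0$ if $\rho(v)=0$, and otherwise $$X(v)=\omega(v)=\sup\Big\{s\in\Theta_{\rho(v)} : c_{\rho(v)}(s)<\min_{0\le j\le n,\ j\ne\rho(v)}c_j(v_j)\Big\},$$ where the supremum of the empty set is the left end point of $\Theta_{\rho(v)}$. Then $(\rho,X)$ is buyer-optimal. 2. Without any assumption on ties, fix a strict priority order on $\{0,1,\dots,n\}$. Let $\rho(v)$ be the participant with the smallest $c_i(v_i)$, ties being broken by the priority; this is a measurable selection from $\arg\min_{0\le i\le n}c_i(v_i)$. Let $X(v)=0$ if $\rho(v)=0$,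 and otherwise let $X(v)$ be given by the same formula with the comparison $c_{\rho(v)}(s)<c_j(v_j)$, for each $j\ne\rho(v)$, replaced by "$c_{\rho(v)}(s)<c_j(v_j)$, or $c_{\rho(v)}(s)=c_j(v_j)$ and $\rho(v)$ has priority over $j$". Then $(\rho,X)$ is buyer-optimal, truthful reporting is a dominant strategy in it, and a truthful bidder never makes a loss. -/

import Mathlib

open MeasureTheory ProbabilityTheory

noncomputable section

/-- A procurement (reverse) auction with `n` bidders in the independent private values model.
The buyer has the known valuation `v0`; bidder `i` has a private cost drawn from a distribution
with density `pdf i`, strictly positive exactly on an interval `Θ i`, its set of possible types. -/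
structure ReverseAuction (n : ℕ) where
  /-- the value of the service to the buyer -/
  v0 : ℝ
  /-- the type intervals; they may be open, closed or half-open, bounded or not -/
  Θ : Fin n → Set ℝ
  ordConnected_Θ : ∀ i, (Θ i).OrdConnected
  /-- the densities of the costs -/
  pdf : Fin n → ℝ → ℝ
  measurable_pdf : ∀ i, Measurable (pdf i)
  pdf_pos : ∀ i, ∀ x ∈ Θ i, 0 < pdf i x
  pdf_eq_zero : ∀ i, ∀ x, x ∉ Θ i → pdf i x = 0
  lintegral_pdf : ∀ i, ∫⁻ x, ENNReal.ofReal (pdf i x) = 1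
  /-- the negative part of each cost has finite expectation; this is automatic for costs that are
  nonnegative or bounded below, and the costs themselves may have infinite expectation -/
  integrable_neg : ∀ i, Integrable (fun x : ℝ => max (-x) 0)
    (volume.withDensity fun x => ENNReal.ofReal (pdf i x))

/-- A direct mechanism, as functions of the profile of reported costs: `alloc v i` is the
probability that bidder `i` is selected, `pay v i` the payment from the buyer to bidder `i`. -/
structure DirectMechanism (n : ℕ) where
  alloc : (Fin n → ℝ) → Fin n → ℝ
  pay : (Fin n → ℝ) → Fin n → ℝ

/-- The deterministic mechanism given by a winner rule `ρ` (where `none` means that the buyer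
does not buy from any bidder) and by the payment `X` to the winner; losers are paid nothing. -/
def DirectMechanism.ofWinner {n : ℕ} (ρ : (Fin n → ℝ) → Option (Fin n)) (X : (Fin n → ℝ) → ℝ) :
    DirectMechanism n where
  alloc v i := if ρ v = some i then 1 else 0
  pay v i := if ρ v = some i then X v else 0

/-- Ex-post utility of bidder `i` with true cost `t` when the reports are `v`. -/
def DirectMechanism.exPostUtility {n : ℕ} (M : DirectMechanism n) (i : Fin n) (t : ℝ)
    (v : Fin n → ℝ) : ℝ :=
  M.pay v i - t * M.alloc v i

namespace ReverseAuction

variable {n : ℕ} (A : ReverseAuction n)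

/-- The distribution of the cost of bidder `i`. -/
def law (i : Fin n) : Measure ℝ :=
  volume.withDensity fun x => ENNReal.ofReal (A.pdf i x)

instance instIsProbabilityMeasureLaw (i : Fin n) : IsProbabilityMeasure (A.law i) :=
  ⟨by rw [law, withDensity_apply _ MeasurableSet.univ, Measure.restrict_univ, A.lintegral_pdf i]⟩

/-- The joint distribution of the costs: they are independent. -/
def joint : Measure (Fin n → ℝ) :=
  Measure.pi A.law

/-- The reverse virtual valuation `c_i(x) = x + F_i(x) / f_i(x)`, used for `x ∈ Θ i`. -/
def virtualValuation (i : Fin n) (x : ℝ) : ℝ :=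
  x + cdf (A.law i) x / A.pdf i x

/-- Regularity: each `c_i` is nondecreasing on the interval `Θ i` (for differentiable `c_i` this
says that the derivative is nonnegative there). -/
def IsRegular : Prop :=
  ∀ i, MonotoneOn (A.virtualValuation i) (A.Θ i)

/-- The virtual valuations of all participants: the buyer `none` has `c_0(v_0) = v_0`. -/
def participantValue (v : Fin n → ℝ) : Option (Fin n) → ℝ
  | none => A.v0
  | some i => A.virtualValuation i (v i)

/-- The profiles of possible types. -/
def typeSpace : Set (Fin n → ℝ) :=
  {v | ∀ i, v i ∈ A.Θ i}

/-- The expected utility of bidder `i` with true cost `t` who reports `r`, when the other bidders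
report truthfully. Since the costs are independent, the conditional expectation given the cost of
bidder `i` is the integral over the joint distribution with coordinate `i` replaced. -/
def interimUtility (M : DirectMechanism n) (i : Fin n) (t r : ℝ) : ℝ :=
  ∫ v, (M.pay (Function.update v i r) i - t * M.alloc (Function.update v i r) i) ∂A.joint

/-- The direct mechanisms the buyer can choose from: selection probabilities, payments with finite
(interim and ex-ante) expectations, Bayesian incentive compatibility, and interim individual
rationality. -/
structure IsFeasible (M : DirectMechanism n) : Prop where
  measurable_alloc : ∀ i, Measurable fun v => M.alloc v i
  measurable_pay : ∀ i, Measurable fun v => M.pay v i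
  alloc_nonneg : ∀ v ∈ A.typeSpace, ∀ i, 0 ≤ M.alloc v i
  sum_alloc_le_one : ∀ v ∈ A.typeSpace, ∑ i, M.alloc v i ≤ 1
  integrable_pay : ∀ i, Integrable (fun v => M.pay v i) A.joint
  integrable_interim_pay : ∀ i, ∀ r ∈ A.Θ i,
    Integrable (fun v => M.pay (Function.update v i r) i) A.joint
  incentive_compatible : ∀ i, ∀ t ∈ A.Θ i, ∀ r ∈ A.Θ i,
    A.interimUtility M i t r ≤ A.interimUtility M i t t
  individually_rational : ∀ i, ∀ t ∈ A.Θ i, 0 ≤ A.interimUtility M i t t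

/-- The expected utility of the buyer, who gains `v0` if some bidder provides the service. -/
def buyerUtility (M : DirectMechanism n) : ℝ :=
  ∫ v, (A.v0 * ∑ i, M.alloc v i - ∑ i, M.pay v i) ∂A.joint

/-- `M` is feasible and maximizes the buyer's expected utility among all feasible mechanisms. -/
def IsBuyerOptimal (M : DirectMechanism n) : Prop :=
  A.IsFeasible M ∧ ∀ M' : DirectMechanism n, A.IsFeasible M' → A.buyerUtility M' ≤ A.buyerUtility M

/-- Truthful reporting is a dominant strategy. -/
def IsDominantStrategyTruthful (M : DirectMechanism n) : Prop :=
  ∀ v ∈ A.typeSpace, ∀ i, ∀ r ∈ A.Θ i,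
    M.exPostUtility i (v i) (Function.update v i r) ≤ M.exPostUtility i (v i) v

/-- No truthful bidder ever makes a loss. -/
def IsExPostRational (M : DirectMechanism n) : Prop :=
  ∀ v ∈ A.typeSpace, ∀ i, 0 ≤ M.exPostUtility i (v i) v

/-- The supremum of a set `S` of possible types of bidder `i`, taken in the order of the type
interval, so that the supremum of the empty set is the left end point of the interval. -/
def typeSup (i : Fin n) (S : Set ℝ) : ℝ :=
  open Classical in if S.Nonempty then sSup S else sInf (A.Θ i)

/-- `ω = sup {s ∈ Θ_i : c_i(s) < min_{j ≠ i} c_j(v_j)}`, the minimum being over the other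
participants, including the buyer. -/
def omega (v : Fin n → ℝ) (i : Fin n) : ℝ :=
  A.typeSup i {s ∈ A.Θ i |
    A.virtualValuation i s < ⨅ j : {j : Option (Fin n) // j ≠ some i}, A.participantValue v j}

/-- The payment that belongs to the winner rule `ρ`: the winner gets `ω`, and no payment is made
if no bidder wins. -/
def payment (ρ : (Fin n → ℝ) → Option (Fin n)) (v : Fin n → ℝ) : ℝ :=
  match ρ v with
  | none => 0
  | some i => A.omega v i

/-- `ρ` selects a participant with the smallest virtual valuation (ties are broken in any
measurable way). -/
structure IsMinimalSelection (ρ : (Fin n → ℝ) → Option (Fin n)) : Prop where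
  measurableSet_fiber : ∀ j, MeasurableSet {v | ρ v = j}
  minimal : ∀ v ∈ A.typeSpace, ∀ j, A.participantValue v (ρ v) ≤ A.participantValue v j

/-- Almost surely no two participants have the same virtual valuation. -/
def AlmostSurelyNoTies : Prop :=
  ∀ j k : Option (Fin n), j ≠ k →
    ∀ᵐ v ∂A.joint, A.participantValue v j ≠ A.participantValue v k

/-! ### Breaking ties by a fixed priority -/

/-- Virtual valuations refined by a priority: compare by the virtual valuation `c` first and, for
equal virtual valuations, by the priority `k` (a smaller number wins). -/
def key (c : ℝ) (k : ℕ) : ℝ ×ₗ ℕ :=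
  toLex (c, k)

/-- The participant with the smallest virtual valuation, ties being broken by the priority. -/
def priorityWinner (prio : Option (Fin n) → ℕ) (v : Fin n → ℝ) : Option (Fin n) :=
  (Finset.exists_min_image Finset.univ (fun j => key (A.participantValue v j) (prio j))
    Finset.univ_nonempty).choose

/-- The supremum of the types with which bidder `i` precedes all other participants, the
virtual valuations being compared with ties broken by the priority. -/
def priorityOmega (prio : Option (Fin n) → ℕ) (v : Fin n → ℝ) (i : Fin n) : ℝ :=
  A.typeSup i {s ∈ A.Θ i | ∀ j : Option (Fin n), j ≠ some i →
    key (A.virtualValuation i s) (prio (some i)) < key (A.participantValue v j) (prio j)}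

/-- The winner is paid `priorityOmega`; no payment is made if no bidder wins. -/
def priorityPayment (prio : Option (Fin n) → ℕ) (v : Fin n → ℝ) : ℝ :=
  match A.priorityWinner prio v with
  | none => 0
  | some i => A.priorityOmega prio v i

end ReverseAuction

end

namespace ReverseAuction

variable {n : ℕ} (A : ReverseAuction n)

/-! ### The distribution of the costs -/

/-! This is Myerson's argument. Incentive compatibility makes the interim winning probability q of a
bidder nonincreasing in the cost and, with individual rationality, bounds the interim utility U(t)
from below by the integral of q over the types above t
(`setLIntegral_Ioi_le_of_incentiveCompatible`). Taking expectations and exchanging the integrals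
turns this bound into E[q F_i / f_i] (`lintegral_mul_rentRate`). Hence every bidder earns at least
the expected virtual rent, and the buyer gets at most the expected virtual surplus E[∑ p_i (v_0 -
c_i)] (`IsFeasible.integral_rent_le`, `IsFeasible.buyerUtility_eq`).

Selecting a participant with minimal c_i maximizes the virtual surplus pointwise. By regularity, the
types that win against given reports of the others form a lower set of Θ_i, up to null events; if
the winner is paid its supremum, the ex-post utility is the length of the set of winning types above
the true cost, so the envelope inequality is an equality and the bound is attained.
`IsThresholdRule` captures what both tie-breaking conventions share. With priorities the cutoff
structure holds at every type profile, whence dominant strategies; without ties it holds almost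
surely.

Neither the costs nor F_i / f_i need be integrable, so rents are first compared as integrals in [0,
∞]. -/

lemma measurableSet_Θ (i : Fin n) : MeasurableSet (A.Θ i) :=
  (A.ordConnected_Θ i).measurableSet

lemma pdf_nonneg (i : Fin n) (x : ℝ) : 0 ≤ A.pdf i x := by
  by_cases h : x ∈ A.Θ i
  · exact (A.pdf_pos i x h).le
  · exact (A.pdf_eq_zero i x h).ge

lemma law_absolutelyContinuous (i : Fin n) : A.law i ≪ volume :=
  withDensity_absolutelyContinuous _ _

instance instNullSingletonClassLaw (i : Fin n) : NullSingletonClass (A.law i) :=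
  ⟨fun x => A.law_absolutelyContinuous i (measure_singleton x)⟩

instance instIsProbabilityMeasureJoint : IsProbabilityMeasure A.joint := by
  unfold joint; infer_instance

/-- The density is positive exactly on `Θ i`, so the law and Lebesgue measure have the same null
sets there. This lets almost sure absence of ties exclude intervals of tying types. -/
lemma law_eq_zero_iff (i : Fin n) {s : Set ℝ} : A.law i s = 0 ↔ volume (A.Θ i ∩ s) = 0 := by
  rw [law, withDensity_apply_eq_zero (A.measurable_pdf i).ennreal_ofReal]
  have : {x | ENNReal.ofReal (A.pdf i x) ≠ 0} = A.Θ i := by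
    ext x
    by_cases h : x ∈ A.Θ i
    · simp [h, A.pdf_pos i x h]
    · simp [h, A.pdf_eq_zero i x h]
  rw [this]

lemma ae_mem_Θ (i : Fin n) : ∀ᵐ x ∂A.law i, x ∈ A.Θ i := by
  rw [ae_iff, law_eq_zero_iff]
  have : A.Θ i ∩ {a | a ∉ A.Θ i} = ∅ := by ext; simp
  simp [this]

lemma ae_mem_typeSpace : ∀ᵐ v ∂A.joint, v ∈ A.typeSpace :=
  ae_all_iff.2 fun i =>
    (measurePreserving_eval A.law i).quasiMeasurePreserving.ae (A.ae_mem_Θ i)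

lemma update_mem_typeSpace {v : Fin n → ℝ} (hv : v ∈ A.typeSpace) {i : Fin n} {r : ℝ}
    (hr : r ∈ A.Θ i) : Function.update v i r ∈ A.typeSpace := by
  intro j
  rcases eq_or_ne j i with rfl | hj
  · simpa using hr
  · simpa [hj] using hv j

lemma measurable_update_uncurry (i : Fin n) :
    Measurable fun p : (Fin n → ℝ) × ℝ => Function.update p.1 i p.2 := by
  refine measurable_pi_iff.2 fun j => ?_
  rcases eq_or_ne j i with rfl | hj
  · simpa using measurable_snd
  · simp only [Function.update_of_ne hj]
    exact (measurable_pi_apply j).comp measurable_fst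

/-- The costs are independent: redrawing the cost of one bidder does not change the joint
distribution. -/
lemma measurePreserving_update (i : Fin n) :
    MeasurePreserving (fun p : (Fin n → ℝ) × ℝ => Function.update p.1 i p.2)
      (A.joint.prod (A.law i)) A.joint := by
  refine ⟨measurable_update_uncurry i, ?_⟩
  refine (Measure.pi_eq fun s hs => ?_).symm
  rw [Measure.map_apply (measurable_update_uncurry i) (MeasurableSet.univ_pi hs)]
  have : (fun p : (Fin n → ℝ) × ℝ => Function.update p.1 i p.2) ⁻¹' Set.univ.pi s
      = (Set.univ.pi (Function.update s i Set.univ)) ×ˢ s i := by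
    ext p
    simp only [Set.mem_preimage, Set.mem_pi, Set.mem_univ, true_imp_iff, Set.mem_prod]
    constructor
    · intro h
      refine ⟨fun j => ?_, by simpa using h i⟩
      rcases eq_or_ne j i with rfl | hj
      · simp
      · simpa [hj] using h j
    · rintro ⟨h, h'⟩ j
      rcases eq_or_ne j i with rfl | hj
      · simpa using h'
      · simpa [hj] using h j
  rw [this, Measure.prod_prod, joint, Measure.pi_pi,
    ← Finset.mul_prod_erase _ _ (Finset.mem_univ i),
    ← Finset.mul_prod_erase Finset.univ (fun j => A.law j (s j)) (Finset.mem_univ i)]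
  simp only [Function.update_self, measure_univ, one_mul]
  rw [mul_comm]
  congr 1
  refine Finset.prod_congr rfl fun j hj => ?_
  simp [Finset.ne_of_mem_erase hj]

lemma ae_ae_update (i : Fin n) {p : (Fin n → ℝ) → Prop} (h : ∀ᵐ v ∂A.joint, p v) :
    ∀ᵐ v ∂A.joint, ∀ᵐ r ∂A.law i, p (Function.update v i r) :=
  Measure.ae_ae_of_ae_prod ((A.measurePreserving_update i).quasiMeasurePreserving.ae h)

lemma integrable_update (i : Fin n) {f : (Fin n → ℝ) → ℝ} (hf : Measurable f) :
    Integrable (fun p : (Fin n → ℝ) × ℝ => f (Function.update p.1 i p.2))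
      (A.joint.prod (A.law i)) ↔ Integrable f A.joint :=
  (A.measurePreserving_update i).integrable_comp hf.aestronglyMeasurable

lemma lintegral_update (i : Fin n) {f : (Fin n → ℝ) → ENNReal} (hf : Measurable f) :
    ∫⁻ r, ∫⁻ v, f (Function.update v i r) ∂A.joint ∂A.law i = ∫⁻ v, f v ∂A.joint := by
  rw [← (A.measurePreserving_update i).lintegral_comp hf, lintegral_prod_symm]
  exact (hf.comp (measurable_update_uncurry i)).aemeasurable

lemma lintegral_update' (i : Fin n) {f : (Fin n → ℝ) → ENNReal} (hf : Measurable f) :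
    ∫⁻ v, ∫⁻ r, f (Function.update v i r) ∂A.law i ∂A.joint = ∫⁻ v, f v ∂A.joint := by
  rw [← (A.measurePreserving_update i).lintegral_comp hf, lintegral_prod]
  exact (hf.comp (measurable_update_uncurry i)).aemeasurable

/-! ### The information rent `F_i / f_i` -/

/-- The quotient `F_i / f_i`, by which the virtual valuation exceeds the cost. -/
noncomputable def rentRate (i : Fin n) (x : ℝ) : ℝ :=
  cdf (A.law i) x / A.pdf i x

lemma virtualValuation_eq (i : Fin n) (x : ℝ) :
    A.virtualValuation i x = x + A.rentRate i x := rfl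

lemma rentRate_nonneg (i : Fin n) (x : ℝ) : 0 ≤ A.rentRate i x :=
  div_nonneg (cdf_nonneg _ _) (A.pdf_nonneg i x)

lemma le_virtualValuation (i : Fin n) (x : ℝ) : x ≤ A.virtualValuation i x :=
  le_add_of_nonneg_right (A.rentRate_nonneg i x)

lemma measurable_rentRate (i : Fin n) : Measurable (A.rentRate i) :=
  (monotone_cdf _).measurable.div (A.measurable_pdf i)

lemma measurable_virtualValuation (i : Fin n) : Measurable (A.virtualValuation i) :=
  measurable_id.add (A.measurable_rentRate i)

/-- Fubini's theorem for the information rent: if a bidder wins with probability `g s` when the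
cost is `s`, then `E[g F_i / f_i]` is the expectation of `∫_t^∞ g`. -/
lemma lintegral_mul_rentRate (i : Fin n) {g : ℝ → ENNReal} (hg : Measurable g) :
    ∫⁻ s, g s * ENNReal.ofReal (A.rentRate i s) ∂A.law i
      = ∫⁻ t, (∫⁻ s in A.Θ i ∩ Set.Ioi t, g s) ∂A.law i := by
  have hΘ := A.measurableSet_Θ i
  have hm : Measurable (Function.uncurry fun t s : ℝ =>
      (A.Θ i ∩ Set.Ioi t).indicator g s) := by
    have : (Function.uncurry fun t s : ℝ => (A.Θ i ∩ Set.Ioi t).indicator g s)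
        = {p : ℝ × ℝ | p.2 ∈ A.Θ i ∧ p.1 < p.2}.indicator fun p => g p.2 := by
      ext p; rfl
    rw [this]
    exact (hg.comp measurable_snd).indicator
      ((measurable_snd hΘ).inter (measurableSet_lt measurable_fst measurable_snd))
  have h1 : ∀ t, ∫⁻ s in A.Θ i ∩ Set.Ioi t, g s
      = ∫⁻ s, (A.Θ i ∩ Set.Ioi t).indicator g s := fun t =>
    (lintegral_indicator (hΘ.inter measurableSet_Ioi) _).symm
  simp_rw [h1]
  have h2 := lintegral_withDensity_eq_lintegral_mul volume (A.measurable_pdf i).ennreal_ofReal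
    (hg.mul (A.measurable_rentRate i).ennreal_ofReal)
  rw [lintegral_lintegral_swap hm.aemeasurable]
  refine h2.trans ?_
  refine lintegral_congr fun s => ?_
  by_cases hs : s ∈ A.Θ i
  -- After the exchange, s is fixed and t ranges over the types below s, a set of probability
  -- F_i(s); the factor f_i(s) cancels the denominator of the rent.
  · have h2 : ∀ t, (A.Θ i ∩ Set.Ioi t).indicator g s = (Set.Iio s).indicator (fun _ => g s) t := by
      intro t
      by_cases ht : t < s <;> simp [hs, ht]
    simp_rw [h2]
    rw [lintegral_indicator_const measurableSet_Iio, Pi.mul_apply, Pi.mul_apply, mul_left_comm,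
      ← ENNReal.ofReal_mul (A.pdf_nonneg i s), rentRate, mul_div_cancel₀ _ (A.pdf_pos i s hs).ne',
      ofReal_cdf, measure_congr Iio_ae_eq_Iic]
  · simp [hs, A.pdf_eq_zero i s hs]

end ReverseAuction

/-! ### The envelope inequality -/

/-- Over N equal pieces of the interval the right sides telescope to (b - a)(q a - q b) / N, which
tends to 0. No continuity of `g` or `q` is needed. -/
lemma le_of_forall_sub_le_mul_sub {g q : ℝ → ℝ} {a b : ℝ} (hab : a ≤ b)
    (h : ∀ s ∈ Set.Icc a b, ∀ s' ∈ Set.Icc a b, s ≤ s' → g s' - g s ≤ (s' - s) * (q s - q s')) :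
    g b ≤ g a := by
  have key : ∀ N : ℕ, 0 < N → N * (g b - g a) ≤ (b - a) * (q a - q b) := by
    intro N hN
    have hN' : (0 : ℝ) < N := by exact_mod_cast hN
    set p : ℕ → ℝ := fun k => a + k * ((b - a) / N) with hp
    have hd : 0 ≤ (b - a) / N := div_nonneg (sub_nonneg.2 hab) hN'.le
    have hp0 : p 0 = a := by simp [hp]
    have hpN : p N = b := by simp only [hp]; field_simp; ring
    have hstep : ∀ k, p (k + 1) - p k = (b - a) / N := by
      intro k; simp only [hp]; push_cast; ring
    have hmono : Monotone p := monotone_nat_of_le_succ fun k => by linarith [hstep k]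
    have hmem : ∀ k ≤ N, p k ∈ Set.Icc a b := fun k hk =>
      ⟨hp0 ▸ hmono (Nat.zero_le k), hpN ▸ hmono hk⟩
    have hsum : ∑ k ∈ Finset.range N, (g (p (k + 1)) - g (p k))
        ≤ ∑ k ∈ Finset.range N, (b - a) / N * (q (p k) - q (p (k + 1))) := by
      refine Finset.sum_le_sum fun k hk => ?_
      have hk := Finset.mem_range.1 hk
      rw [← hstep k]
      exact h _ (hmem k hk.le) _ (hmem (k + 1) hk) (hmono k.le_succ)
    rw [← Finset.mul_sum, Finset.sum_range_sub (fun k => g (p k)),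
      Finset.sum_range_sub' (fun k => q (p k)), hp0, hpN] at hsum
    calc N * (g b - g a) ≤ N * ((b - a) / N * (q a - q b)) :=
          mul_le_mul_of_nonneg_left hsum hN'.le
      _ = (b - a) * (q a - q b) := by field_simp
  by_contra! hlt
  obtain ⟨N, hN⟩ := exists_nat_gt ((b - a) * (q a - q b) / (g b - g a))
  have hpos : 0 < g b - g a := sub_pos.2 hlt
  rw [div_lt_iff₀ hpos] at hN
  have := key (N + 1) N.succ_pos
  push_cast at this
  nlinarith

/-- The envelope inequality: a nonnegative interim utility `U` for which misreports do not pay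
dominates the integral of the winning probability `q` over the higher types. -/
lemma setLIntegral_Ioi_le_of_incentiveCompatible {Θ : Set ℝ} (hΘ : Θ.OrdConnected) {U q : ℝ → ℝ}
    (hq : ∀ t ∈ Θ, 0 ≤ q t) (hU : ∀ t ∈ Θ, 0 ≤ U t)
    (hIC : ∀ t ∈ Θ, ∀ r ∈ Θ, U r + (r - t) * q r ≤ U t) {t : ℝ} (ht : t ∈ Θ) :
    ∫⁻ s in Θ ∩ Set.Ioi t, ENNReal.ofReal (q s) ≤ ENNReal.ofReal (U t) := by
  -- Add the two constraints that keep x and y from imitating each other.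
  have hanti : AntitoneOn q Θ := by
    intro x hx y hy hxy
    rcases hxy.eq_or_lt with rfl | hlt
    · exact le_rfl
    · nlinarith [hIC x hx y hy, hIC y hy x hx]
  have hint : ∀ x ∈ Θ, ∀ y ∈ Θ, IntervalIntegrable q volume x y := fun x hx y hy =>
    (hanti.mono (hΘ.uIcc_subset hx hy)).intervalIntegrable
  have hstep : ∀ b ∈ Θ, t < b →
      ∫⁻ s in Set.Ioc t b, ENNReal.ofReal (q s) ≤ ENNReal.ofReal (U t) := by
    intro b hb htb
    have hsub : Set.Icc t b ⊆ Θ := hΘ.out ht hb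
    -- For s ≤ s', the constraint of type s gives U(s') - U(s) ≤ -(s' - s) q(s'), and the integral
    -- of q over [s, s'] is at most (s' - s) q(s) by monotonicity. The sum is the required increment
    -- bound, so U(b) plus the integral of q from t to b is at most U(t).
    have h := le_of_forall_sub_le_mul_sub (g := fun s => U s + ∫ x in t..s, q x) (q := q) htb.le
      (by
        intro s hs s' hs' hss
        have e := intervalIntegral.integral_add_adjacent_intervals
          (hint t ht s (hsub hs)) (hint s (hsub hs) s' (hsub hs'))
        have e2 : ∫ x in s..s', q x ≤ ∫ x in s..s', q s :=
          intervalIntegral.integral_mono_on hss (hint s (hsub hs) s' (hsub hs'))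
            intervalIntegrable_const fun x hx =>
              hanti (hsub hs) (hΘ.out (hsub hs) (hsub hs') hx) hx.1
        rw [intervalIntegral.integral_const, smul_eq_mul] at e2
        have := hIC s (hsub hs) s' (hsub hs')
        nlinarith)
    simp only [intervalIntegral.integral_same, add_zero] at h
    rw [intervalIntegral.integral_of_le htb.le] at h
    rw [← ofReal_integral_eq_lintegral_ofReal (hint t ht b hb).1]
    · exact ENNReal.ofReal_le_ofReal (by linarith [hU b hb])
    · filter_upwards [ae_restrict_mem measurableSet_Ioc] with x hx
      exact hq x (hsub ⟨hx.1.le, hx.2⟩)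
  -- `Θ` may be unbounded or lack its right end point, so it is exhausted by intervals with rational
  -- ends; only a greatest element can be missed, and it is null.
  let ι := {b : ℚ // (b : ℝ) ∈ Θ ∧ t < b}
  have hcover : (Θ ∩ Set.Ioi t : Set ℝ) ≤ᵐ[volume] (⋃ b : ι, Set.Ioc t (b.1 : ℝ) : Set ℝ) := by
    have hnull : volume {x ∈ Θ | ∀ y ∈ Θ, y ≤ x} = 0 :=
      Set.Subsingleton.measure_zero (fun x hx y hy => le_antisymm (hy.2 x hx.1) (hx.2 y hy.1)) _
    filter_upwards [measure_eq_zero_iff_ae_notMem.1 hnull] with x hx hxt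
    have hx' : ∃ y ∈ Θ, x < y := by
      by_contra! h
      exact hx ⟨hxt.1, h⟩
    obtain ⟨y, hy, hxy⟩ := hx'
    obtain ⟨b, hb1, hb2⟩ := exists_rat_btwn hxy
    exact Set.mem_iUnion.2 ⟨⟨b, hΘ.out hxt.1 hy ⟨hb1.le, hb2.le⟩, lt_trans hxt.2 hb1⟩,
      hxt.2, hb1.le⟩
  have hdir : Directed (· ⊆ ·) fun b : ι => Set.Ioc t (b.1 : ℝ) := by
    have : Monotone fun b : ι => Set.Ioc t (b.1 : ℝ) := fun b c hbc =>
      Set.Ioc_subset_Ioc_right (by exact_mod_cast hbc)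
    exact this.directed_le
  calc ∫⁻ s in Θ ∩ Set.Ioi t, ENNReal.ofReal (q s)
      ≤ ∫⁻ s in ⋃ b : ι, Set.Ioc t (b.1 : ℝ), ENNReal.ofReal (q s) := lintegral_mono_set' hcover
    _ = ⨆ b : ι, ∫⁻ s in Set.Ioc t (b.1 : ℝ), ENNReal.ofReal (q s) :=
        setLIntegral_iUnion_of_directed _ hdir
    _ ≤ ENNReal.ofReal (U t) := iSup_le fun b => hstep b.1 b.2.1 b.2.2

namespace ReverseAuction

variable {n : ℕ} {A : ReverseAuction n} {M : DirectMechanism n}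

/-! ### Feasible mechanisms -/

/-- The probability with which bidder `i` expects to be selected when reporting `r`. -/
noncomputable def interimAlloc (A : ReverseAuction n) (M : DirectMechanism n) (i : Fin n) (r : ℝ) :
    ℝ :=
  ∫ v, M.alloc (Function.update v i r) i ∂A.joint

/-- The payment that bidder `i` expects when reporting `r`. -/
noncomputable def interimPay (A : ReverseAuction n) (M : DirectMechanism n) (i : Fin n) (r : ℝ) :
    ℝ :=
  ∫ v, M.pay (Function.update v i r) i ∂A.joint

namespace IsFeasible

lemma alloc_le_one (hM : A.IsFeasible M) {v : Fin n → ℝ} (hv : v ∈ A.typeSpace) (i : Fin n) :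
    M.alloc v i ≤ 1 :=
  (Finset.single_le_sum (fun j _ => hM.alloc_nonneg v hv j) (Finset.mem_univ i)).trans
    (hM.sum_alloc_le_one v hv)

lemma integrable_alloc (hM : A.IsFeasible M) (i : Fin n) :
    Integrable (fun v => M.alloc v i) A.joint := by
  refine Integrable.of_bound (hM.measurable_alloc i).aestronglyMeasurable 1 ?_
  filter_upwards [A.ae_mem_typeSpace] with v hv
  rw [Real.norm_of_nonneg (hM.alloc_nonneg v hv i)]
  exact hM.alloc_le_one hv i

lemma measurable_alloc_update (hM : A.IsFeasible M) (i : Fin n) (r : ℝ) :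
    Measurable fun v => M.alloc (Function.update v i r) i :=
  (hM.measurable_alloc i).comp ((measurable_update_uncurry i).comp measurable_prodMk_right)

lemma integrable_interim_alloc (hM : A.IsFeasible M) {i : Fin n} {r : ℝ} (hr : r ∈ A.Θ i) :
    Integrable (fun v => M.alloc (Function.update v i r) i) A.joint := by
  refine Integrable.of_bound (hM.measurable_alloc_update i r).aestronglyMeasurable 1 ?_
  filter_upwards [A.ae_mem_typeSpace] with v hv
  have hv' := A.update_mem_typeSpace hv hr
  rw [Real.norm_of_nonneg (hM.alloc_nonneg _ hv' i)]
  exact hM.alloc_le_one hv' i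

lemma interimAlloc_nonneg (hM : A.IsFeasible M) {i : Fin n} {r : ℝ} (hr : r ∈ A.Θ i) :
    0 ≤ A.interimAlloc M i r := by
  refine integral_nonneg_of_ae ?_
  filter_upwards [A.ae_mem_typeSpace] with v hv
  exact hM.alloc_nonneg _ (A.update_mem_typeSpace hv hr) i

lemma interimUtility_eq (hM : A.IsFeasible M) {i : Fin n} (t : ℝ) {r : ℝ} (hr : r ∈ A.Θ i) :
    A.interimUtility M i t r = A.interimPay M i r - t * A.interimAlloc M i r := by
  rw [interimUtility, integral_sub (hM.integrable_interim_pay i r hr)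
    ((hM.integrable_interim_alloc hr).const_mul t), integral_const_mul]
  rfl

/-- Individual rationality thus controls the expected cost of a high-cost bidder by the payment,
which replaces a finite mean of the cost. -/
lemma mul_interimAlloc_le (hM : A.IsFeasible M) {i : Fin n} {t : ℝ} (ht : t ∈ A.Θ i) :
    t * A.interimAlloc M i t ≤ A.interimPay M i t := by
  have := hM.individually_rational i t ht
  rw [hM.interimUtility_eq t ht] at this
  linarith

lemma measurable_interimAlloc (hM : A.IsFeasible M) (i : Fin n) :
    Measurable (A.interimAlloc M i) :=
  (((hM.measurable_alloc i).comp
    (measurable_update_uncurry i)).stronglyMeasurable.integral_prod_left').measurable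

lemma interimAlloc_le_one (hM : A.IsFeasible M) {i : Fin n} {r : ℝ} (hr : r ∈ A.Θ i) :
    A.interimAlloc M i r ≤ 1 := by
  have : A.interimAlloc M i r ≤ ∫ _, (1 : ℝ) ∂A.joint := by
    refine integral_mono_ae (hM.integrable_interim_alloc hr) (integrable_const _) ?_
    filter_upwards [A.ae_mem_typeSpace] with v hv
    exact hM.alloc_le_one (A.update_mem_typeSpace hv hr) i
  simpa using this

lemma integrable_interimPay (hM : A.IsFeasible M) (i : Fin n) :
    Integrable (A.interimPay M i) (A.law i) :=
  ((A.integrable_update i (hM.measurable_pay i)).2 (hM.integrable_pay i)).integral_prod_right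

/-- The expected cost of production of each bidder is finite. -/
lemma integrable_cost (hM : A.IsFeasible M) (i : Fin n) :
    Integrable (fun v => v i * M.alloc v i) A.joint := by
  have hmeas : Measurable fun v : Fin n → ℝ => v i * M.alloc v i :=
    (measurable_pi_apply i).mul (hM.measurable_alloc i)
  have hmeas' := hmeas.comp (measurable_update_uncurry i)
  rw [← A.integrable_update i hmeas]
  refine (integrable_prod_iff' hmeas'.aestronglyMeasurable).2 ⟨?_, ?_⟩
  · filter_upwards [A.ae_mem_Θ i] with r hr
    simpa using (hM.integrable_interim_alloc hr).const_mul r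
  · refine ((hM.integrable_interimPay i).norm.add (A.integrable_neg i)).mono'
      hmeas'.stronglyMeasurable.norm.integral_prod_left'.aestronglyMeasurable ?_
    filter_upwards [A.ae_mem_Θ i] with r hr
    have h : ∫ v, ‖Function.update v i r i * M.alloc (Function.update v i r) i‖ ∂A.joint
        = |r| * A.interimAlloc M i r := by
      rw [interimAlloc, ← integral_const_mul]
      refine integral_congr_ae ?_
      filter_upwards [A.ae_mem_typeSpace] with v hv
      rw [Function.update_self, norm_mul, Real.norm_eq_abs,
        Real.norm_of_nonneg (hM.alloc_nonneg _ (A.update_mem_typeSpace hv hr) i)]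
    have h0 := hM.interimAlloc_nonneg hr
    have h1 := hM.interimAlloc_le_one hr
    have h2 := hM.mul_interimAlloc_le hr
    simp only [Function.comp_apply]
    rw [h, Real.norm_of_nonneg (by positivity), Pi.add_apply, Real.norm_eq_abs]
    -- Positive costs are dominated by the interim payment, negative ones by the integrable negative
    -- part, as the winning probability is at most 1.
    rcases le_total 0 r with hr0 | hr0
    · rw [abs_of_nonneg hr0]
      linarith [le_abs_self (A.interimPay M i r), le_max_right (-r) 0]
    · rw [abs_of_nonpos hr0]
      nlinarith [abs_nonneg (A.interimPay M i r), le_max_left (-r) 0]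

lemma integrable_utility (hM : A.IsFeasible M) (i : Fin n) :
    Integrable (fun v => M.pay v i - v i * M.alloc v i) A.joint :=
  (hM.integrable_pay i).sub (hM.integrable_cost i)

/-- The expectation of the interim utility of a bidder. -/
lemma integral_interimUtility (hM : A.IsFeasible M) (i : Fin n) :
    Integrable (fun t => A.interimUtility M i t t) (A.law i) ∧
      ∫ t, A.interimUtility M i t t ∂A.law i
        = ∫ v, (M.pay v i - v i * M.alloc v i) ∂A.joint := by
  have hmeasU : Measurable fun v : Fin n → ℝ => M.pay v i - v i * M.alloc v i :=
    (hM.measurable_pay i).sub ((measurable_pi_apply i).mul (hM.measurable_alloc i))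
  have hU := (A.integrable_update i hmeasU).2 (hM.integrable_utility i)
  have hUeq : ∀ t, ∫ v, (M.pay (Function.update v i t) i
      - Function.update v i t i * M.alloc (Function.update v i t) i) ∂A.joint
      = A.interimUtility M i t t := fun t => by simp [interimUtility]
  constructor
  · simpa only [hUeq] using hU.integral_prod_right
  · simp_rw [← hUeq]
    rw [← (A.measurePreserving_update i).map_eq, integral_map
      (measurable_update_uncurry i).aemeasurable hmeasU.aestronglyMeasurable,
      (A.measurePreserving_update i).map_eq, integral_prod_symm _ hU]

lemma integral_utility_nonneg (hM : A.IsFeasible M) (i : Fin n) :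
    0 ≤ ∫ v, (M.pay v i - v i * M.alloc v i) ∂A.joint := by
  rw [← (hM.integral_interimUtility i).2]
  refine integral_nonneg_of_ae ?_
  filter_upwards [A.ae_mem_Θ i] with t ht using hM.individually_rational i t ht

/-- The expected virtual rent of a bidder is at most the expected utility. -/
lemma lintegral_rent_le (hM : A.IsFeasible M) (i : Fin n) :
    ∫⁻ v, ENNReal.ofReal (M.alloc v i) * ENNReal.ofReal (A.rentRate i (v i)) ∂A.joint
      ≤ ENNReal.ofReal (∫ v, (M.pay v i - v i * M.alloc v i) ∂A.joint) := by
  have hmeas : Measurable fun v : Fin n → ℝ =>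
      ENNReal.ofReal (M.alloc v i) * ENNReal.ofReal (A.rentRate i (v i)) :=
    (hM.measurable_alloc i).ennreal_ofReal.mul
      ((A.measurable_rentRate i).comp (measurable_pi_apply i)).ennreal_ofReal
  calc ∫⁻ v, ENNReal.ofReal (M.alloc v i) * ENNReal.ofReal (A.rentRate i (v i)) ∂A.joint
      = ∫⁻ r, ENNReal.ofReal (A.interimAlloc M i r) * ENNReal.ofReal (A.rentRate i r)
          ∂A.law i := by
        rw [← A.lintegral_update i hmeas]
        refine lintegral_congr_ae ?_
        filter_upwards [A.ae_mem_Θ i] with r hr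
        simp only [Function.update_self]
        rw [lintegral_mul_const _ (hM.measurable_alloc_update i r).ennreal_ofReal, interimAlloc,
          ofReal_integral_eq_lintegral_ofReal (hM.integrable_interim_alloc hr)]
        filter_upwards [A.ae_mem_typeSpace] with v hv
        exact hM.alloc_nonneg _ (A.update_mem_typeSpace hv hr) i
    _ = ∫⁻ t, (∫⁻ s in A.Θ i ∩ Set.Ioi t, ENNReal.ofReal (A.interimAlloc M i s)) ∂A.law i :=
        A.lintegral_mul_rentRate i (hM.measurable_interimAlloc i).ennreal_ofReal
    _ ≤ ∫⁻ t, ENNReal.ofReal (A.interimUtility M i t t) ∂A.law i := by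
        refine lintegral_mono_ae ?_
        filter_upwards [A.ae_mem_Θ i] with t ht
        refine setLIntegral_Ioi_le_of_incentiveCompatible (A.ordConnected_Θ i)
          (U := fun t => A.interimUtility M i t t)
          (fun r hr => hM.interimAlloc_nonneg hr) (hM.individually_rational i) ?_ ht
        -- Type t reporting r gets what type r gets, plus the cost difference (r - t) whenever
        -- selected.
        intro t ht r hr
        refine le_of_eq_of_le ?_ (hM.incentive_compatible i t ht r hr)
        rw [hM.interimUtility_eq _ hr, hM.interimUtility_eq _ hr]
        ring
    _ = ENNReal.ofReal (∫ v, (M.pay v i - v i * M.alloc v i) ∂A.joint) := by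
        rw [← (hM.integral_interimUtility i).2]
        refine (ofReal_integral_eq_lintegral_ofReal (hM.integral_interimUtility i).1 ?_).symm
        filter_upwards [A.ae_mem_Θ i] with t ht using hM.individually_rational i t ht

lemma rent_nonneg (hM : A.IsFeasible M) (i : Fin n) :
    0 ≤ᵐ[A.joint] fun v => M.alloc v i * A.rentRate i (v i) := by
  filter_upwards [A.ae_mem_typeSpace] with v hv
  exact mul_nonneg (hM.alloc_nonneg v hv i) (A.rentRate_nonneg i _)

lemma lintegral_rent_eq (hM : A.IsFeasible M) (i : Fin n) :
    ∫⁻ v, ENNReal.ofReal (M.alloc v i * A.rentRate i (v i)) ∂A.joint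
      = ∫⁻ v, ENNReal.ofReal (M.alloc v i) * ENNReal.ofReal (A.rentRate i (v i)) ∂A.joint := by
  refine lintegral_congr_ae ?_
  filter_upwards [A.ae_mem_typeSpace] with v hv
  exact ENNReal.ofReal_mul (hM.alloc_nonneg v hv i)

/-- Finiteness comes from the envelope bound: the rent is dominated in expectation by the bidder's
finite expected utility. -/
lemma integrable_rent (hM : A.IsFeasible M) (i : Fin n) :
    Integrable (fun v => M.alloc v i * A.rentRate i (v i)) A.joint := by
  refine ⟨((hM.measurable_alloc i).mul
    ((A.measurable_rentRate i).comp (measurable_pi_apply i))).aestronglyMeasurable, ?_⟩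
  rw [hasFiniteIntegral_iff_ofReal (hM.rent_nonneg i), hM.lintegral_rent_eq i]
  exact (hM.lintegral_rent_le i).trans_lt ENNReal.ofReal_lt_top

lemma ofReal_integral_rent (hM : A.IsFeasible M) (i : Fin n) :
    ENNReal.ofReal (∫ v, M.alloc v i * A.rentRate i (v i) ∂A.joint)
      = ∫⁻ v, ENNReal.ofReal (M.alloc v i) * ENNReal.ofReal (A.rentRate i (v i)) ∂A.joint := by
  rw [ofReal_integral_eq_lintegral_ofReal (hM.integrable_rent i) (hM.rent_nonneg i),
    hM.lintegral_rent_eq i]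

lemma integral_rent_le (hM : A.IsFeasible M) (i : Fin n) :
    ∫ v, M.alloc v i * A.rentRate i (v i) ∂A.joint
      ≤ ∫ v, (M.pay v i - v i * M.alloc v i) ∂A.joint := by
  rw [← ENNReal.ofReal_le_ofReal_iff (hM.integral_utility_nonneg i), hM.ofReal_integral_rent i]
  exact hM.lintegral_rent_le i

lemma integrable_virtualSurplus (hM : A.IsFeasible M) :
    Integrable (fun v => ∑ i, M.alloc v i * (A.v0 - A.virtualValuation i (v i))) A.joint := by
  refine integrable_finsetSum _ fun i _ => ?_
  refine ((((hM.integrable_alloc i).const_mul A.v0).sub (hM.integrable_cost i)).sub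
    (hM.integrable_rent i)).congr (Filter.Eventually.of_forall fun v => ?_)
  simp only [Pi.sub_apply, virtualValuation_eq]
  ring

/-- The buyer's expected utility is the expected virtual surplus, less what the bidders get in
excess of their virtual rents. -/
lemma buyerUtility_eq (hM : A.IsFeasible M) :
    A.buyerUtility M
      = ∫ v, ∑ i, M.alloc v i * (A.v0 - A.virtualValuation i (v i)) ∂A.joint
        - ∑ i, (∫ v, (M.pay v i - v i * M.alloc v i) ∂A.joint
          - ∫ v, M.alloc v i * A.rentRate i (v i) ∂A.joint) := by
  have h : ∀ i, ∫ v, (M.pay v i - v i * M.alloc v i) ∂A.joint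
      - ∫ v, M.alloc v i * A.rentRate i (v i) ∂A.joint
      = ∫ v, (M.pay v i - v i * M.alloc v i - M.alloc v i * A.rentRate i (v i)) ∂A.joint :=
    fun i => (integral_sub (hM.integrable_utility i) (hM.integrable_rent i)).symm
  have hint : ∀ i ∈ Finset.univ, Integrable (fun v : Fin n → ℝ =>
      M.pay v i - v i * M.alloc v i - M.alloc v i * A.rentRate i (v i)) A.joint :=
    fun i _ => (hM.integrable_utility i).sub (hM.integrable_rent i)
  simp_rw [h]
  rw [← integral_finsetSum _ hint,
    ← integral_sub hM.integrable_virtualSurplus (integrable_finsetSum _ hint)]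
  refine integral_congr_ae (Filter.Eventually.of_forall fun v => ?_)
  simp only
  rw [Finset.mul_sum, ← Finset.sum_sub_distrib, ← Finset.sum_sub_distrib]
  refine Finset.sum_congr rfl fun i _ => ?_
  rw [virtualValuation_eq]
  ring

end IsFeasible

/-- A feasible mechanism in which no bidder gets more than the virtual rent is optimal if it
maximizes the virtual surplus pointwise. -/
lemma isBuyerOptimal_of_virtualSurplus (hM : A.IsFeasible M)
    (hrent : ∀ i, ∫ v, (M.pay v i - v i * M.alloc v i) ∂A.joint
      ≤ ∫ v, M.alloc v i * A.rentRate i (v i) ∂A.joint)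
    (hmax : ∀ v ∈ A.typeSpace, ∀ a : Fin n → ℝ, (∀ i, 0 ≤ a i) → ∑ i, a i ≤ 1 →
      ∑ i, a i * (A.v0 - A.virtualValuation i (v i))
        ≤ ∑ i, M.alloc v i * (A.v0 - A.virtualValuation i (v i))) :
    A.IsBuyerOptimal M := by
  refine ⟨hM, fun M' hM' => ?_⟩
  rw [hM.buyerUtility_eq, hM'.buyerUtility_eq]
  have h1 : ∑ i, (∫ v, (M.pay v i - v i * M.alloc v i) ∂A.joint
      - ∫ v, M.alloc v i * A.rentRate i (v i) ∂A.joint) ≤ 0 :=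
    Finset.sum_nonpos fun i _ => sub_nonpos.2 (hrent i)
  have h2 : 0 ≤ ∑ i, (∫ v, (M'.pay v i - v i * M'.alloc v i) ∂A.joint
      - ∫ v, M'.alloc v i * A.rentRate i (v i) ∂A.joint) :=
    Finset.sum_nonneg fun i _ => sub_nonneg.2 (hM'.integral_rent_le i)
  have h3 : ∫ v, ∑ i, M'.alloc v i * (A.v0 - A.virtualValuation i (v i)) ∂A.joint
      ≤ ∫ v, ∑ i, M.alloc v i * (A.v0 - A.virtualValuation i (v i)) ∂A.joint := by
    refine integral_mono_ae hM'.integrable_virtualSurplus hM.integrable_virtualSurplus ?_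
    filter_upwards [A.ae_mem_typeSpace] with v hv
    exact hmax v hv _ (hM'.alloc_nonneg v hv) (hM'.sum_alloc_le_one v hv)
  linarith

end ReverseAuction

namespace ReverseAuction

variable {n : ℕ} {A : ReverseAuction n}

/-! ### Threshold rules -/

/-- `W` is the set of reports with which bidder `i` wins against fixed reports of the others. It
is a lower set of types, and `S` is the same set, possibly without its greatest element. -/
structure IsCutoff (A : ReverseAuction n) (i : Fin n) (S W : Set ℝ) : Prop where
  subset_win : S ⊆ W
  win_subset : W ⊆ A.Θ i
  mem_of_lt : ∀ r ∈ W, ∀ t ∈ A.Θ i, t < r → t ∈ S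
  le_v0 : ∀ r ∈ W, r ≤ A.v0

namespace IsCutoff

variable {i : Fin n} {S W : Set ℝ}

lemma bddAbove (h : A.IsCutoff i S W) : BddAbove S :=
  ⟨A.v0, fun s hs => h.le_v0 s (h.subset_win hs)⟩

/-- A winning type above the supremum of `S` would leave room for a smaller type, in `S` by the
cutoff property, that also exceeds it. If `S` is empty, the winning type is the least of `Θ i`. So
the price covers the winner's cost. -/
lemma le_typeSup (h : A.IsCutoff i S W) {r : ℝ} (hr : r ∈ W) : r ≤ A.typeSup i S := by
  rw [typeSup]
  split_ifs with hne
  · obtain ⟨s, hs⟩ := hne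
    by_contra! hlt
    obtain ⟨t, ht1, ht2⟩ := exists_between hlt
    have hst : s ≤ t := (le_csSup h.bddAbove hs).trans ht1.le
    have htΘ : t ∈ A.Θ i := (A.ordConnected_Θ i).out (h.win_subset (h.subset_win hs))
      (h.win_subset hr) ⟨hst, ht2.le⟩
    exact absurd (le_csSup h.bddAbove (h.mem_of_lt r hr t htΘ ht2)) (not_le.2 ht1)
  · refine le_csInf ⟨r, h.win_subset hr⟩ fun t ht => ?_
    by_contra! hlt
    exact hne ⟨t, h.mem_of_lt r hr t ht hlt⟩

lemma typeSup_le (h : A.IsCutoff i S W) {r : ℝ} (hr : r ∈ W) {t : ℝ} (ht : t ∈ A.Θ i)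
    (htS : t ∉ S) : A.typeSup i S ≤ t := by
  rw [typeSup]
  split_ifs with hne
  · refine csSup_le hne fun s hs => ?_
    by_contra! hlt
    exact htS (h.mem_of_lt s (h.subset_win hs) t ht hlt)
  -- With `S` empty, the winning type `r` is a lower bound of `Θ i`; otherwise `sInf` could be the
  -- default value 0.
  · refine csInf_le ⟨r, fun x hx => ?_⟩ ht
    by_contra! hlt
    exact hne ⟨x, h.mem_of_lt r hr x hx hlt⟩

/-- With `le_typeSup`, this confines the price to the range from the winner's cost to `A.v0`, which
makes payments integrable. -/
lemma typeSup_le_v0 (h : A.IsCutoff i S W) {r : ℝ} (hr : r ∈ W) : A.typeSup i S ≤ A.v0 := by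
  by_cases hrS : r ∈ S
  · rw [typeSup, if_pos ⟨r, hrS⟩]
    exact csSup_le ⟨r, hrS⟩ fun s hs => h.le_v0 s (h.subset_win hs)
  · exact (h.typeSup_le hr (h.win_subset hr) hrS).trans (h.le_v0 r hr)

/-- Against a threshold price, no misreport is better than the truth. -/
lemma indicator_le (h : A.IsCutoff i S W) {t : ℝ} (ht : t ∈ A.Θ i) (r : ℝ) :
    W.indicator (fun _ => A.typeSup i S - t) r ≤ W.indicator (fun _ => A.typeSup i S - t) t := by
  by_cases hr : r ∈ W
  · by_cases htW : t ∈ W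
    · simp [hr, htW]
    · have := h.typeSup_le hr ht fun hS => htW (h.subset_win hS)
      simp [hr, htW, this]
  · simp only [Set.indicator_of_notMem hr]
    exact Set.indicator_apply_nonneg fun htW => sub_nonneg.2 (h.le_typeSup htW)

/-- This is the equality case of the envelope inequality: if r wins, the winning types above r fill
the interval from r to the price, up to end points; if r loses, no higher type wins. -/
lemma volume_win_inter_Ioi (h : A.IsCutoff i S W) (r : ℝ) (hr : r ∈ A.Θ i) :
    volume (W ∩ (A.Θ i ∩ Set.Ioi r))
      = ENNReal.ofReal (W.indicator (fun _ => A.typeSup i S - r) r) := by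
  by_cases hW : r ∈ W
  · rw [Set.indicator_of_mem hW]
    refine le_antisymm ?_ ?_
    · rw [← Real.volume_Ioc]
      exact measure_mono fun s hs => ⟨hs.2.2, h.le_typeSup hs.1⟩
    · rw [← Real.volume_Ioo]
      refine measure_mono fun s hs => ?_
      have hne : S.Nonempty := by
        by_contra hne
        have : r ∉ S := fun hrS => hne ⟨r, hrS⟩
        exact absurd (h.typeSup_le hW hr this) (not_le.2 (hs.1.trans hs.2))
      have hs2 := hs.2
      rw [typeSup, if_pos hne] at hs2
      obtain ⟨x, hx, hsx⟩ := exists_lt_of_lt_csSup hne hs2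
      have hxW := h.subset_win hx
      have hsΘ := (A.ordConnected_Θ i).out hr (h.win_subset hxW) ⟨hs.1.le, hsx.le⟩
      exact ⟨h.subset_win (h.mem_of_lt x hxW s hsΘ hsx), hsΘ, hs.1⟩
  · rw [Set.indicator_of_notMem hW, ENNReal.ofReal_zero]
    have : W ∩ (A.Θ i ∩ Set.Ioi r) = ∅ := by
      refine Set.eq_empty_of_forall_notMem fun s hs => hW ?_
      exact h.subset_win (h.mem_of_lt s hs.1 r hr hs.2.2)
    rw [this, measure_empty]

end IsCutoff

/-- The supremum and the emptiness test reduce to a countable set of types. Rationals suffice,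
except that `S v` may consist of the least type of `Θ i` alone, so that type is added. -/
lemma measurable_typeSup {α : Type*} [MeasurableSpace α] (i : Fin n) {S : α → Set ℝ}
    (hsub : ∀ v, S v ⊆ A.Θ i) (hlow : ∀ v, ∀ s ∈ S v, ∀ t ∈ A.Θ i, t ≤ s → t ∈ S v)
    (hbdd : ∀ v, BddAbove (S v)) (hmeas : ∀ s, MeasurableSet {v | s ∈ S v}) :
    Measurable fun v => A.typeSup i (S v) := by
  obtain ⟨D, hD, hDS⟩ : ∃ D : Set ℝ, D.Countable ∧ ∀ v, ∀ s ∈ S v, ∀ a < s, ∃ d ∈ D,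
      a < d ∧ d ∈ S v := by
    refine ⟨Set.range ((↑) : ℚ → ℝ) ∪ {x ∈ A.Θ i | ∀ y ∈ A.Θ i, x ≤ y},
      (Set.countable_range _).union (Set.Subsingleton.countable fun x hx y hy =>
        le_antisymm (hx.2 y hy.1) (hy.2 x hx.1)), fun v s hs a ha => ?_⟩
    by_cases hmin : ∀ y ∈ A.Θ i, s ≤ y
    · exact ⟨s, Or.inr ⟨hsub v hs, hmin⟩, ha, hs⟩
    · push Not at hmin
      obtain ⟨y, hy, hys⟩ := hmin
      obtain ⟨d, hd1, hd2⟩ := exists_rat_btwn (max_lt ha hys)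
      exact ⟨d, Or.inl ⟨d, rfl⟩, (le_max_left _ _).trans_lt hd1,
        hlow v s hs d ((A.ordConnected_Θ i).out hy (hsub v hs)
          ⟨((le_max_right _ _).trans_lt hd1).le, hd2.le⟩) hd2.le⟩
  refine measurable_of_Ioi fun a => ?_
  have hne : MeasurableSet {v | (S v).Nonempty} := by
    have : {v | (S v).Nonempty} = ⋃ d ∈ D, {v | d ∈ S v} := by
      ext v
      simp only [Set.mem_ofPred_eq, Set.mem_iUnion, exists_prop]
      constructor
      · rintro ⟨s, hs⟩
        obtain ⟨d, hd, -, hdS⟩ := hDS v s hs (s - 1) (sub_one_lt s)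
        exact ⟨d, hd, hdS⟩
      · rintro ⟨d, -, hd⟩
        exact ⟨d, hd⟩
    rw [this]
    exact MeasurableSet.biUnion hD fun d _ => hmeas d
  have : (fun v => A.typeSup i (S v)) ⁻¹' Set.Ioi a
      = (⋃ d ∈ D ∩ Set.Ioi a, {v | d ∈ S v}) ∪
        ({v | (S v).Nonempty}ᶜ ∩ {_v | a < sInf (A.Θ i)}) := by
    ext v
    simp only [Set.mem_preimage, Set.mem_Ioi, typeSup, Set.mem_union, Set.mem_iUnion,
      Set.mem_inter_iff, Set.mem_compl_iff, Set.mem_ofPred_eq, exists_prop]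
    split_ifs with h
    · simp only [h, not_true_eq_false, false_and, or_false]
      constructor
      · intro ha
        obtain ⟨s, hs, has⟩ := exists_lt_of_lt_csSup h ha
        obtain ⟨d, hd, had, hdS⟩ := hDS v s hs a has
        exact ⟨d, ⟨hd, had⟩, hdS⟩
      · rintro ⟨d, ⟨-, had⟩, hdS⟩
        exact had.trans_le (le_csSup (hbdd v) hdS)
    · simp only [h, not_false_eq_true, true_and]
      refine ⟨Or.inr, ?_⟩
      rintro (⟨d, -, hdS⟩ | h')
      · exact absurd ⟨d, hdS⟩ h
      · exact h'
  rw [this]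
  exact (MeasurableSet.biUnion (hD.mono Set.inter_subset_left) fun d _ => hmeas d).union
    (hne.compl.inter (MeasurableSet.const _))

/-- The reports with which bidder `i` wins, given the reports of the others. -/
def winSet (A : ReverseAuction n) (ρ : (Fin n → ℝ) → Option (Fin n)) (i : Fin n)
    (v : Fin n → ℝ) : Set ℝ :=
  {r ∈ A.Θ i | ρ (Function.update v i r) = some i}

/-- A selection `ρ` with the smallest virtual valuation in which bidder `i` wins with the types in
`S i v`, which depends on the other reports only, and with at most one more type. -/
structure IsThresholdRule (A : ReverseAuction n) (ρ : (Fin n → ℝ) → Option (Fin n))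
    (S : Fin n → (Fin n → ℝ) → Set ℝ) : Prop where
  selection : A.IsMinimalSelection ρ
  subset : ∀ i v, S i v ⊆ A.Θ i
  lower : ∀ i v, ∀ s ∈ S i v, ∀ t ∈ A.Θ i, t ≤ s → t ∈ S i v
  bddAbove : ∀ i v, BddAbove (S i v)
  measurableSet : ∀ i s, MeasurableSet {v | s ∈ S i v}
  update : ∀ i v r, S i (Function.update v i r) = S i v
  wins : ∀ i, ∀ v ∈ A.typeSpace, S i v ⊆ A.winSet ρ i v
  mem_of_lt : ∀ i, ∀ᵐ v ∂A.joint, ∀ r ∈ A.winSet ρ i v, ∀ t ∈ A.Θ i, t < r → t ∈ S i v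

lemma IsMinimalSelection.le_v0 {ρ : (Fin n → ℝ) → Option (Fin n)} (h : A.IsMinimalSelection ρ)
    {v : Fin n → ℝ} (hv : v ∈ A.typeSpace) {i : Fin n} {r : ℝ} (hr : r ∈ A.winSet ρ i v) :
    r ≤ A.v0 := by
  have := h.minimal _ (A.update_mem_typeSpace hv hr.1) none
  rw [hr.2] at this
  simp only [participantValue, Function.update_self] at this
  exact (A.le_virtualValuation i r).trans this

/-- Each v_0 - c_i is at most v_0 - min c, which is nonnegative because the buyer is among the
participants; weights of total mass at most 1 cannot beat it. -/
lemma IsMinimalSelection.virtualSurplus_le {ρ : (Fin n → ℝ) → Option (Fin n)}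
    {X : (Fin n → ℝ) → ℝ} (h : A.IsMinimalSelection ρ) {v : Fin n → ℝ} (hv : v ∈ A.typeSpace)
    {a : Fin n → ℝ} (ha : ∀ i, 0 ≤ a i) (ha' : ∑ i, a i ≤ 1) :
    ∑ i, a i * (A.v0 - A.virtualValuation i (v i))
      ≤ ∑ i, (DirectMechanism.ofWinner ρ X).alloc v i
          * (A.v0 - A.virtualValuation i (v i)) := by
  have hsum : ∑ i, (DirectMechanism.ofWinner ρ X).alloc v i
      * (A.v0 - A.virtualValuation i (v i)) = A.v0 - A.participantValue v (ρ v) := by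
    cases hρ : ρ v with
    | none => simp [DirectMechanism.ofWinner, hρ, participantValue]
    | some j => simp [DirectMechanism.ofWinner, hρ, participantValue]
  have hmin := h.minimal v hv
  have h0 : 0 ≤ A.v0 - A.participantValue v (ρ v) := sub_nonneg.2 (hmin none)
  rw [hsum]
  calc ∑ i, a i * (A.v0 - A.virtualValuation i (v i))
      ≤ ∑ i, a i * (A.v0 - A.participantValue v (ρ v)) :=
        Finset.sum_le_sum fun i _ =>
          mul_le_mul_of_nonneg_left (sub_le_sub_left (hmin (some i)) _) (ha i)
    _ = (∑ i, a i) * (A.v0 - A.participantValue v (ρ v)) := (Finset.sum_mul _ _ _).symm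
    _ ≤ A.v0 - A.participantValue v (ρ v) := mul_le_of_le_one_left h0 ha'

namespace IsThresholdRule

variable {ρ : (Fin n → ℝ) → Option (Fin n)} {S : Fin n → (Fin n → ℝ) → Set ℝ}
  {X : (Fin n → ℝ) → ℝ}

lemma ae_isCutoff (h : A.IsThresholdRule ρ S) (i : Fin n) :
    ∀ᵐ v ∂A.joint, v ∈ A.typeSpace ∧ A.IsCutoff i (S i v) (A.winSet ρ i v) := by
  filter_upwards [h.mem_of_lt i, A.ae_mem_typeSpace] with v hv hvΘ
  exact ⟨hvΘ, h.wins i v hvΘ, fun r hr => hr.1, hv, fun r hr => h.selection.le_v0 hvΘ hr⟩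

/-- The ex-post utility of a bidder who pays the threshold price. -/
lemma exPostUtility_update (h : A.IsThresholdRule ρ S)
    (hX : ∀ v i, ρ v = some i → X v = A.typeSup i (S i v)) (i : Fin n) (v : Fin n → ℝ) (t : ℝ)
    {r : ℝ} (hr : r ∈ A.Θ i) :
    (DirectMechanism.ofWinner ρ X).exPostUtility i t (Function.update v i r)
      = (A.winSet ρ i v).indicator (fun _ => A.typeSup i (S i v) - t) r := by
  by_cases hw : ρ (Function.update v i r) = some i
  · have : r ∈ A.winSet ρ i v := ⟨hr, hw⟩
    simp [DirectMechanism.exPostUtility, DirectMechanism.ofWinner, hw, this, hX _ _ hw, h.update]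
  · have : r ∉ A.winSet ρ i v := fun hr => hw hr.2
    simp [DirectMechanism.exPostUtility, DirectMechanism.ofWinner, hw, this]

lemma measurable_alloc (h : A.IsThresholdRule ρ S) (i : Fin n) :
    Measurable fun v => (DirectMechanism.ofWinner ρ X).alloc v i :=
  Measurable.ite (h.selection.measurableSet_fiber (some i)) measurable_const measurable_const

lemma measurable_pay (h : A.IsThresholdRule ρ S)
    (hX : ∀ v i, ρ v = some i → X v = A.typeSup i (S i v)) (i : Fin n) :
    Measurable fun v => (DirectMechanism.ofWinner ρ X).pay v i := by
  have : (fun v => (DirectMechanism.ofWinner ρ X).pay v i)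
      = fun v => if ρ v = some i then A.typeSup i (S i v) else 0 := by
    funext v
    by_cases hw : ρ v = some i
    · simp [DirectMechanism.ofWinner, hw, hX _ _ hw]
    · simp [DirectMechanism.ofWinner, hw]
  rw [this]
  exact Measurable.ite (h.selection.measurableSet_fiber (some i))
    (measurable_typeSup i (h.subset i) (h.lower i) (h.bddAbove i) (h.measurableSet i))
    measurable_const

lemma abs_pay_le (h : A.IsThresholdRule ρ S)
    (hX : ∀ v i, ρ v = some i → X v = A.typeSup i (S i v)) {i : Fin n} {v : Fin n → ℝ}
    (hv : A.IsCutoff i (S i v) (A.winSet ρ i v)) {r : ℝ} (hr : r ∈ A.Θ i) :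
    ‖(DirectMechanism.ofWinner ρ X).pay (Function.update v i r) i‖ ≤ |A.v0| + max (-r) 0 := by
  by_cases hw : ρ (Function.update v i r) = some i
  · have hrW : r ∈ A.winSet ρ i v := ⟨hr, hw⟩
    have h1 := hv.le_typeSup hrW
    have h2 := hv.typeSup_le_v0 hrW
    simp only [DirectMechanism.ofWinner, hw, if_true, hX _ _ hw, h.update, Real.norm_eq_abs]
    rw [abs_le]
    constructor <;>
    linarith [le_abs_self A.v0, abs_nonneg A.v0, le_max_left (-r) 0, le_max_right (-r) 0]
  · simp only [DirectMechanism.ofWinner, hw, if_false, norm_zero]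
    positivity

/-- For almost all reports of the others truth is ex-post optimal and yields no loss; integration
gives the interim constraints. -/
lemma isFeasible (h : A.IsThresholdRule ρ S)
    (hX : ∀ v i, ρ v = some i → X v = A.typeSup i (S i v)) :
    A.IsFeasible (DirectMechanism.ofWinner ρ X) := by
  have hint : ∀ i, ∀ r ∈ A.Θ i, Integrable
      (fun v => (DirectMechanism.ofWinner ρ X).pay (Function.update v i r) i) A.joint := by
    intro i r hr
    refine Integrable.of_bound ((h.measurable_pay hX i).comp
      ((measurable_update_uncurry i).comp measurable_prodMk_right)).aestronglyMeasurable
      (|A.v0| + max (-r) 0) ?_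
    filter_upwards [h.ae_isCutoff i] with v hv using h.abs_pay_le hX hv.2 hr
  have hinta : ∀ i r, Integrable
      (fun v => (DirectMechanism.ofWinner ρ X).alloc (Function.update v i r) i) A.joint := by
    intro i r
    refine Integrable.of_bound ((h.measurable_alloc i).comp
      ((measurable_update_uncurry i).comp measurable_prodMk_right)).aestronglyMeasurable 1 ?_
    refine Filter.Eventually.of_forall fun v => ?_
    simp only [DirectMechanism.ofWinner]
    split_ifs <;> simp
  have hintu : ∀ i t, ∀ r ∈ A.Θ i, Integrable
      (fun v => (DirectMechanism.ofWinner ρ X).exPostUtility i t (Function.update v i r))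
      A.joint := fun i t r hr => (hint i r hr).sub ((hinta i r).const_mul t)
  refine ⟨h.measurable_alloc, h.measurable_pay hX, fun v _ i => ?_, fun v _ => ?_, fun i => ?_,
    hint, fun i t ht r hr => ?_, fun i t ht => ?_⟩
  · simp only [DirectMechanism.ofWinner]
    split_ifs <;> simp
  · cases hρ : ρ v <;> simp [DirectMechanism.ofWinner, hρ]
  · refine ((integrable_const |A.v0|).add
      ((measurePreserving_eval A.law i).integrable_comp_of_integrable
        (A.integrable_neg i))).mono' (h.measurable_pay hX i).aestronglyMeasurable ?_
    filter_upwards [h.ae_isCutoff i] with v hv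
    simpa using h.abs_pay_le hX hv.2 (hv.1 i)
  · refine integral_mono_ae (hintu i t r hr) (hintu i t t ht) ?_
    filter_upwards [h.ae_isCutoff i] with v hv
    exact le_of_eq_of_le (h.exPostUtility_update hX i v t hr)
      (le_of_le_of_eq (hv.2.indicator_le ht r) (h.exPostUtility_update hX i v t ht).symm)
  · refine integral_nonneg_of_ae ?_
    filter_upwards [h.ae_isCutoff i] with v hv
    refine le_of_le_of_eq ?_ (h.exPostUtility_update hX i v t ht).symm
    exact Set.indicator_apply_nonneg fun htW => sub_nonneg.2 (hv.2.le_typeSup htW)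

/-- With the other reports fixed, the Fubini identity for the indicator of the winning set replaces
the rent by the length of the winning types above the true cost, which is the ex-post utility. -/
lemma lintegral_rent_eq (h : A.IsThresholdRule ρ S)
    (hX : ∀ v i, ρ v = some i → X v = A.typeSup i (S i v)) (i : Fin n) :
    ∫⁻ v, ENNReal.ofReal ((DirectMechanism.ofWinner ρ X).alloc v i)
        * ENNReal.ofReal (A.rentRate i (v i)) ∂A.joint
      = ∫⁻ v, ENNReal.ofReal ((DirectMechanism.ofWinner ρ X).pay v i
        - v i * (DirectMechanism.ofWinner ρ X).alloc v i) ∂A.joint := by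
  have hm1 : Measurable fun v => ENNReal.ofReal ((DirectMechanism.ofWinner ρ X).alloc v i)
        * ENNReal.ofReal (A.rentRate i (v i)) :=
    (h.measurable_alloc i).ennreal_ofReal.mul
      ((A.measurable_rentRate i).comp (measurable_pi_apply i)).ennreal_ofReal
  have hm2 : Measurable fun v => ENNReal.ofReal ((DirectMechanism.ofWinner ρ X).pay v i
        - v i * (DirectMechanism.ofWinner ρ X).alloc v i) :=
    ((h.measurable_pay hX i).sub
      ((measurable_pi_apply i).mul (h.measurable_alloc i))).ennreal_ofReal
  rw [← A.lintegral_update' i hm1, ← A.lintegral_update' i hm2]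
  refine lintegral_congr_ae ?_
  filter_upwards [h.ae_isCutoff i] with v hv
  have hW : MeasurableSet (A.winSet ρ i v) :=
    (A.measurableSet_Θ i).inter (((measurable_update_uncurry i).comp
      (measurable_prodMk_left (x := v))) (h.selection.measurableSet_fiber (some i)))
  calc ∫⁻ r, ENNReal.ofReal ((DirectMechanism.ofWinner ρ X).alloc (Function.update v i r) i)
        * ENNReal.ofReal (A.rentRate i (Function.update v i r i)) ∂A.law i
      = ∫⁻ r, (A.winSet ρ i v).indicator 1 r * ENNReal.ofReal (A.rentRate i r) ∂A.law i := by
        refine lintegral_congr_ae ?_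
        filter_upwards [A.ae_mem_Θ i] with r hr
        by_cases hw : ρ (Function.update v i r) = some i
        · have : r ∈ A.winSet ρ i v := ⟨hr, hw⟩
          simp [DirectMechanism.ofWinner, hw, this]
        · have : r ∉ A.winSet ρ i v := fun hr => hw hr.2
          simp [DirectMechanism.ofWinner, hw, this]
    _ = ∫⁻ t, (∫⁻ s in A.Θ i ∩ Set.Ioi t, (A.winSet ρ i v).indicator 1 s) ∂A.law i :=
        A.lintegral_mul_rentRate i (measurable_one.indicator hW)
    _ = _ := by
        refine lintegral_congr_ae ?_
        filter_upwards [A.ae_mem_Θ i] with r hr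
        rw [lintegral_indicator_one hW, Measure.restrict_apply hW,
          hv.2.volume_win_inter_Ioi r hr, ← h.exPostUtility_update hX i v r hr,
          Function.update_self]
        rfl

theorem isBuyerOptimal (h : A.IsThresholdRule ρ S)
    (hX : ∀ v i, ρ v = some i → X v = A.typeSup i (S i v)) :
    A.IsBuyerOptimal (DirectMechanism.ofWinner ρ X) := by
  have hM := h.isFeasible hX
  refine isBuyerOptimal_of_virtualSurplus hM (fun i => ?_)
    fun v hv a ha ha' => h.selection.virtualSurplus_le hv ha ha'
  have hr : 0 ≤ ∫ v, (DirectMechanism.ofWinner ρ X).alloc v i * A.rentRate i (v i) ∂A.joint :=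
    integral_nonneg_of_ae (hM.rent_nonneg i)
  rw [← ENNReal.ofReal_le_ofReal_iff hr, hM.ofReal_integral_rent i, h.lintegral_rent_eq hX i,
    ofReal_integral_eq_lintegral_ofReal (hM.integrable_utility i)]
  filter_upwards [h.ae_isCutoff i] with v hv
  have := h.exPostUtility_update hX i v (v i) (hv.1 i)
  rw [Function.update_eq_self] at this
  refine le_of_le_of_eq ?_ this.symm
  exact Set.indicator_apply_nonneg fun htW => sub_nonneg.2 (hv.2.le_typeSup htW)

end IsThresholdRule

end ReverseAuction

namespace ReverseAuction

variable {n : ℕ} (A : ReverseAuction n)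

lemma measurable_participantValue (j : Option (Fin n)) :
    Measurable fun v => A.participantValue v j := by
  cases j with
  | none => exact measurable_const
  | some i => exact (A.measurable_virtualValuation i).comp (measurable_pi_apply i)

lemma participantValue_update_of_ne {i : Fin n} {j : Option (Fin n)} (hj : j ≠ some i)
    (v : Fin n → ℝ) (r : ℝ) :
    A.participantValue (Function.update v i r) j = A.participantValue v j := by
  cases j with
  | none => rfl
  | some k =>
    have : k ≠ i := fun h => hj (congrArg some h)
    simp [participantValue, this]

lemma participantValue_update_self (i : Fin n) (v : Fin n → ℝ) (r : ℝ) :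
    A.participantValue (Function.update v i r) (some i) = A.virtualValuation i r := by
  simp [participantValue]

/-! ### Selections when ties have probability zero -/

/-- The smallest virtual valuation of the other participants. -/
noncomputable def othersMin (i : Fin n) (v : Fin n → ℝ) : ℝ :=
  ⨅ j : {j : Option (Fin n) // j ≠ some i}, A.participantValue v j

instance instNonemptyOthers (i : Fin n) : Nonempty {j : Option (Fin n) // j ≠ some i} :=
  ⟨⟨none, by simp⟩⟩

lemma othersMin_le {i : Fin n} {j : Option (Fin n)} (hj : j ≠ some i) (v : Fin n → ℝ) :
    A.othersMin i v ≤ A.participantValue v j :=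
  ciInf_le (Set.finite_range _).bddBelow (⟨j, hj⟩ : {j : Option (Fin n) // j ≠ some i})

lemma exists_othersMin_eq (i : Fin n) (v : Fin n → ℝ) :
    ∃ j : Option (Fin n), j ≠ some i ∧ A.participantValue v j = A.othersMin i v := by
  obtain ⟨j, hj⟩ := exists_eq_ciInf_of_finite
    (f := fun j : {j : Option (Fin n) // j ≠ some i} => A.participantValue v j)
  exact ⟨j, j.2, hj⟩

lemma othersMin_update (i : Fin n) (v : Fin n → ℝ) (r : ℝ) :
    A.othersMin i (Function.update v i r) = A.othersMin i v :=
  iInf_congr fun j => A.participantValue_update_of_ne j.2 v r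

lemma measurable_othersMin (i : Fin n) : Measurable (A.othersMin i) :=
  Measurable.iInf fun j => A.measurable_participantValue j

variable {A}

/-- Almost surely, at most one type of a bidder ties with the other participants. -/
lemma AlmostSurelyNoTies.ae_subsingleton (h : A.AlmostSurelyNoTies) (hreg : A.IsRegular)
    (i : Fin n) :
    ∀ᵐ v ∂A.joint, {x ∈ A.Θ i | A.virtualValuation i x = A.othersMin i v}.Subsingleton := by
  have h1 : ∀ᵐ v ∂A.joint, ∀ j, j ≠ some i →
      A.participantValue v (some i) ≠ A.participantValue v j :=
    ae_all_iff.2 fun j => by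
      by_cases hj : j = some i
      · simp [hj]
      · filter_upwards [h (some i) j (Ne.symm hj)] with v hv _ using hv
  filter_upwards [A.ae_ae_update i h1] with v hv
  have h2 : ∀ᵐ r ∂A.law i, A.virtualValuation i r ≠ A.othersMin i v := by
    filter_upwards [hv] with r hr
    obtain ⟨j, hj, hjm⟩ := A.exists_othersMin_eq i v
    have := hr j hj
    rwa [A.participantValue_update_self, A.participantValue_update_of_ne hj, hjm] at this
  rw [ae_iff, law_eq_zero_iff] at h2
  have key : ∀ x ∈ A.Θ i, ∀ y ∈ A.Θ i, A.virtualValuation i x = A.othersMin i v →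
      A.virtualValuation i y = A.othersMin i v → y ≤ x := by
    intro x hx y hy hxm hym
    by_contra! hlt
    -- A monotone c_i is constant between two tying types, so a whole interval of positive length
    -- would tie.
    have hsub : Set.Icc x y ⊆ A.Θ i ∩ {r | ¬ A.virtualValuation i r ≠ A.othersMin i v} := by
      intro z hz
      have hzΘ := (A.ordConnected_Θ i).out hx hy hz
      refine ⟨hzΘ, not_not.2 (le_antisymm ?_ ?_)⟩
      · exact hym ▸ hreg i hzΘ hy hz.2
      · exact hxm ▸ hreg i hx hzΘ hz.1
    have h0 := measure_mono_null hsub h2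
    rw [Real.volume_Icc, ENNReal.ofReal_eq_zero] at h0
    linarith
  exact fun x hx y hy => le_antisymm (key y hy.1 x hx.1 hy.2 hx.2) (key x hx.1 y hy.1 hx.2 hy.2)

/-- A type strictly below the others' minimum must win, and a winner is weakly below it. The gap
consists of tying types, almost surely at most one. -/
lemma IsMinimalSelection.isThresholdRule (hreg : A.IsRegular) (hties : A.AlmostSurelyNoTies)
    {ρ : (Fin n → ℝ) → Option (Fin n)} (hρ : A.IsMinimalSelection ρ) :
    A.IsThresholdRule ρ fun i v => {s ∈ A.Θ i | A.virtualValuation i s < A.othersMin i v} where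
  selection := hρ
  subset _ _ _ hs := hs.1
  lower i v s hs t ht hts := ⟨ht, (hreg i ht hs.1 hts).trans_lt hs.2⟩
  bddAbove i v := ⟨A.othersMin i v, fun s hs => (A.le_virtualValuation i s).trans hs.2.le⟩
  measurableSet i s :=
    (MeasurableSet.const _).inter (measurableSet_lt measurable_const (A.measurable_othersMin i))
  update i v r := by simp only [A.othersMin_update]
  wins i v hv r hr := by
    refine ⟨hr.1, ?_⟩
    by_contra hne
    have h1 := hρ.minimal _ (A.update_mem_typeSpace hv hr.1) (some i)
    rw [A.participantValue_update_self, A.participantValue_update_of_ne hne] at h1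
    exact absurd (h1.trans_lt hr.2) (not_lt.2 (A.othersMin_le hne v))
  mem_of_lt i := by
    filter_upwards [hties.ae_subsingleton hreg i, A.ae_mem_typeSpace] with v hv hvΘ r hr t ht htr
    have hle : A.virtualValuation i r ≤ A.othersMin i v := by
      obtain ⟨j, hj, hjm⟩ := A.exists_othersMin_eq i v
      have h1 := hρ.minimal _ (A.update_mem_typeSpace hvΘ hr.1) j
      rwa [hr.2, A.participantValue_update_self, A.participantValue_update_of_ne hj, hjm] at h1
    have hmono := hreg i ht hr.1 htr.le
    refine ⟨ht, (hmono.trans hle).lt_of_ne fun heq => htr.ne ?_⟩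
    -- If t tied, the larger winning type r would tie as well by regularity.
    exact hv ⟨ht, heq⟩ ⟨hr.1, le_antisymm hle (heq ▸ hmono)⟩

/-! ### Selections by priority -/

lemma measurableSet_key_lt {α : Type*} [MeasurableSpace α] {f g : α → ℝ} (hf : Measurable f)
    (hg : Measurable g) (k l : ℕ) : MeasurableSet {v | key (f v) k < key (g v) l} := by
  simp only [key, Prod.Lex.toLex_lt_toLex]
  exact (measurableSet_lt hf hg).union ((measurableSet_eq_fun hf hg).inter (MeasurableSet.const _))

lemma le_of_key_le {c d : ℝ} {k l : ℕ} (h : key c k ≤ key d l) : c ≤ d := by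
  rcases Prod.Lex.toLex_le_toLex.1 h with h | h
  · exact h.le
  · exact h.1.le

lemma key_le_key {c d : ℝ} (h : c ≤ d) (k : ℕ) : key c k ≤ key d k :=
  Prod.Lex.toLex_mono (Prod.mk_le_mk.2 ⟨h, le_rfl⟩)

variable {prio : Option (Fin n) → ℕ}

lemma key_priorityWinner_le (v : Fin n → ℝ) (j : Option (Fin n)) :
    key (A.participantValue v (A.priorityWinner prio v)) (prio (A.priorityWinner prio v))
      ≤ key (A.participantValue v j) (prio j) :=
  (Finset.exists_min_image Finset.univ (fun j => key (A.participantValue v j) (prio j))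
    Finset.univ_nonempty).choose_spec.2 j (Finset.mem_univ j)

/-- Injective priorities make the keys of distinct participants distinct, so the minimum is strict.
-/
lemma priorityWinner_eq_iff (hprio : Function.Injective prio) {v : Fin n → ℝ}
    {j : Option (Fin n)} :
    A.priorityWinner prio v = j ↔ ∀ k, k ≠ j →
      key (A.participantValue v j) (prio j) < key (A.participantValue v k) (prio k) := by
  constructor
  · rintro rfl k hk
    refine (key_priorityWinner_le v k).lt_of_ne fun h => hk ?_
    exact (hprio (congrArg (fun p => (ofLex p).2) h)).symm
  · intro h
    by_contra hne
    exact absurd (h _ hne) (not_lt.2 (key_priorityWinner_le v j))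

lemma isMinimalSelection_priorityWinner (hprio : Function.Injective prio) :
    A.IsMinimalSelection (A.priorityWinner prio) where
  measurableSet_fiber j := by
    simp only [priorityWinner_eq_iff hprio, Set.ofPred_forall]
    exact MeasurableSet.iInter fun k => MeasurableSet.iInter fun _ =>
      measurableSet_key_lt (A.measurable_participantValue j) (A.measurable_participantValue k) _ _
  minimal v _ j := le_of_key_le (key_priorityWinner_le v j)

/-- The types with which bidder `i` precedes all other participants. -/
def precedingTypes (A : ReverseAuction n) (prio : Option (Fin n) → ℕ) (i : Fin n)
    (v : Fin n → ℝ) : Set ℝ :=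
  {s ∈ A.Θ i | ∀ j : Option (Fin n), j ≠ some i →
    key (A.virtualValuation i s) (prio (some i)) < key (A.participantValue v j) (prio j)}

lemma winSet_priorityWinner (hprio : Function.Injective prio) (i : Fin n) (v : Fin n → ℝ) :
    A.winSet (A.priorityWinner prio) i v = A.precedingTypes prio i v := by
  ext r
  refine and_congr_right fun _ => ?_
  rw [priorityWinner_eq_iff hprio]
  refine forall₂_congr fun j hj => ?_
  rw [A.participantValue_update_self, A.participantValue_update_of_ne hj]

lemma lower_precedingTypes (hreg : A.IsRegular) {i : Fin n} {v : Fin n → ℝ} {s t : ℝ}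
    (hs : s ∈ A.precedingTypes prio i v) (ht : t ∈ A.Θ i) (hts : t ≤ s) :
    t ∈ A.precedingTypes prio i v :=
  ⟨ht, fun j hj => (key_le_key (hreg i ht hs.1 hts) _).trans_lt (hs.2 j hj)⟩

lemma isThresholdRule_priorityWinner (hreg : A.IsRegular) (hprio : Function.Injective prio) :
    A.IsThresholdRule (A.priorityWinner prio) (A.precedingTypes prio) where
  selection := isMinimalSelection_priorityWinner hprio
  subset _ _ _ hs := hs.1
  lower _ _ _ hs _ ht hts := lower_precedingTypes hreg hs ht hts
  bddAbove i _ := ⟨A.v0, fun s hs => (A.le_virtualValuation i s).trans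
    (le_of_key_le (hs.2 none (by simp)).le)⟩
  measurableSet i s := by
    have : {v | s ∈ A.precedingTypes prio i v} = {_v | s ∈ A.Θ i} ∩
        ⋂ j : Option (Fin n), ⋂ _ : j ≠ some i, {v | key (A.virtualValuation i s) (prio (some i))
          < key (A.participantValue v j) (prio j)} := by
      ext v; simp [precedingTypes]
    rw [this]
    exact (MeasurableSet.const _).inter (MeasurableSet.iInter fun j => MeasurableSet.iInter fun _ =>
      measurableSet_key_lt measurable_const (A.measurable_participantValue j) _ _)
  update i v r := by
    ext s
    refine and_congr_right fun _ => forall₂_congr fun j hj => ?_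
    rw [A.participantValue_update_of_ne hj]
  wins i v _ := (winSet_priorityWinner hprio i v).ge
  mem_of_lt i := Filter.Eventually.of_forall fun v r hr t ht htr =>
    lower_precedingTypes hreg ((winSet_priorityWinner hprio i v).subset hr) ht htr.le

/-- Here `S` equals the winning set, so the cutoff property holds at every type profile; dominance
and ex-post rationality need this, an almost sure version would not do. -/
lemma isCutoff_precedingTypes (hreg : A.IsRegular) (hprio : Function.Injective prio) (i : Fin n)
    {v : Fin n → ℝ} (hv : v ∈ A.typeSpace) :
    A.IsCutoff i (A.precedingTypes prio i v) (A.winSet (A.priorityWinner prio) i v) where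
  subset_win := (winSet_priorityWinner hprio i v).ge
  win_subset _ hr := hr.1
  mem_of_lt _ hr _ ht htr :=
    lower_precedingTypes hreg ((winSet_priorityWinner hprio i v).subset hr) ht htr.le
  le_v0 _ hr := (isMinimalSelection_priorityWinner hprio).le_v0 hv hr

lemma priorityPayment_eq {v : Fin n → ℝ} {i : Fin n} (h : A.priorityWinner prio v = some i) :
    A.priorityPayment prio v = A.typeSup i (A.precedingTypes prio i v) := by
  rw [priorityPayment, h]; rfl

lemma payment_eq {ρ : (Fin n → ℝ) → Option (Fin n)} {v : Fin n → ℝ} {i : Fin n}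
    (h : ρ v = some i) :
    A.payment ρ v
      = A.typeSup i {s ∈ A.Θ i | A.virtualValuation i s < A.othersMin i v} := by
  rw [payment, h]; rfl

end ReverseAuction

theorem mainTheorem1 {n : ℕ} (A : ReverseAuction n) (hreg : A.IsRegular) :
    (A.AlmostSurelyNoTies →
      ∀ ρ : (Fin n → ℝ) → Option (Fin n), A.IsMinimalSelection ρ →
        A.IsBuyerOptimal (DirectMechanism.ofWinner ρ (A.payment ρ))) ∧
    (∀ prio : Option (Fin n) → ℕ, Function.Injective prio →
      A.IsMinimalSelection (A.priorityWinner prio) ∧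
      A.IsDominantStrategyTruthful
        (DirectMechanism.ofWinner (A.priorityWinner prio) (A.priorityPayment prio)) ∧
      A.IsExPostRational
        (DirectMechanism.ofWinner (A.priorityWinner prio) (A.priorityPayment prio)) ∧
      A.IsBuyerOptimal
        (DirectMechanism.ofWinner (A.priorityWinner prio) (A.priorityPayment prio))) := by
  refine ⟨fun hties ρ hρ => (hρ.isThresholdRule hreg hties).isBuyerOptimal
    fun v i h => ReverseAuction.payment_eq h, fun prio hprio => ?_⟩
  have hthr := ReverseAuction.isThresholdRule_priorityWinner hreg hprio
  have hX : ∀ v i, A.priorityWinner prio v = some i →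
      A.priorityPayment prio v = A.typeSup i (A.precedingTypes prio i v) :=
    fun v i h => ReverseAuction.priorityPayment_eq h
  have htruth : ∀ v ∈ A.typeSpace, ∀ i, (DirectMechanism.ofWinner (A.priorityWinner prio)
      (A.priorityPayment prio)).exPostUtility i (v i) v
      = (A.winSet (A.priorityWinner prio) i v).indicator
        (fun _ => A.typeSup i (A.precedingTypes prio i v) - v i) (v i) := by
    intro v hv i
    simpa using hthr.exPostUtility_update hX i v (v i) (hv i)
  refine ⟨ReverseAuction.isMinimalSelection_priorityWinner hprio, fun v hv i r hr => ?_,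
    fun v hv i => ?_, hthr.isBuyerOptimal hX⟩
  · rw [htruth v hv i, hthr.exPostUtility_update hX i v (v i) hr]
    exact (ReverseAuction.isCutoff_precedingTypes hreg hprio i hv).indicator_le (hv i) r
  · rw [htruth v hv i]
    exact Set.indicator_apply_nonneg fun hw =>
      sub_nonneg.2 ((ReverseAuction.isCutoff_precedingTypes hreg hprio i hv).le_typeSup hw)
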